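/- **Theorem 3.1.** Let $\delta>0$ and let $y:\mathbb R\to\mathbb R$ be the solution of the Duffing problem $$\ddot y(t)+y(t)+y(t)^3=0,\qquad y(0)=\delta,\quad \dot y(0)=0 .$$ If $\gamma=0$, then the trivial solution $\xi\equiv0$ of the Hill equation $$\ddot\xi(t)+\big(\gamma+y(t)^2\big)\,\xi(t)=0$$ is stable. That is, for every $t_0\in\mathbb R$ and every $\varepsilon>0$ there is $\eta>0$ such that every solution $\xi$ with $|\xi(t_0)|<\eta$ and $|\dot\xi(t_0)|<\eta$ satisfies $|\xi(t)|<\varepsilon$ and $|\dot\xi(t)|<\varepsilon$ for all $t\in\mathbb R$; and (equivalently) every solution $\xi$ of this equation is bounded on $\mathbb R$. -/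

import Mathlib

/-- `y` is the (twice continuously differentiable, globally defined) solution of the Duffing
equation `y'' + y + y ^ 3 = 0` with initial values `y 0 = δ`, `y' 0 = 0`. -/
structure IsDuffingSolution (δ : ℝ) (y : ℝ → ℝ) : Prop where
  contDiff : ContDiff ℝ 2 y
  ode : ∀ t, deriv (deriv y) t + y t + y t ^ 3 = 0
  init : y 0 = δ
  init_deriv : deriv y 0 = 0

/-- `ξ` is a classical solution on `ℝ` of the Hill equation `ξ'' + p ξ = 0`. -/
structure IsHillSolution (p ξ : ℝ → ℝ) : Prop where
  contDiff : ContDiff ℝ 2 ξ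
  ode : ∀ t, deriv (deriv ξ) t + p t * ξ t = 0

/-- Lyapunov stability, in the phase plane and on the whole time line, of the trivial solution
`ξ = 0` of the Hill equation `ξ'' + p ξ = 0`. -/
def TrivialSolutionStable (p : ℝ → ℝ) : Prop :=
  ∀ t₀ : ℝ, ∀ ε > 0, ∃ η > 0, ∀ ξ : ℝ → ℝ, IsHillSolution p ξ →
    |ξ t₀| < η → |deriv ξ t₀| < η → ∀ t : ℝ, |ξ t| < ε ∧ |deriv ξ t| < ε

/-- All solutions of the Hill equation `ξ'' + p ξ = 0` are bounded on `ℝ`. -/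
def AllSolutionsBounded (p : ℝ → ℝ) : Prop :=
  ∀ ξ : ℝ → ℝ, IsHillSolution p ξ → ∃ C : ℝ, ∀ t : ℝ, |ξ t| ≤ C

/-- The coefficient `γ + y ^ 2` of the Hill equation. -/
def squaredDuffing (γ : ℝ) (y : ℝ → ℝ) (t : ℝ) : ℝ := γ + y t ^ 2

/-!
The proof rests on an explicit quadratic first integral. If `y'' + y + y³ = 0` and
`ξ'' + y² ξ = 0`, then

  `I = 2 ξ'² + y² ξ² + (y ξ' - y' ξ)²`

does not depend on time (`hillInvariant_eq`). It comes from Hermite's method for Lamé's equation: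
`P = 2 + y²` satisfies the equation `P''' + 4 y² P' + 4 y y' P = 0` of products of two solutions of
the Hill equation, and `I = P ξ'² - P' ξ ξ' + (P'' / 2 + y² P) ξ²` is the quadratic first integral
attached to `P`.

As a form in `(ξ, ξ')`, `I` has reduced discriminant `2 y'² + 2 y² + y⁴`, which is four times the energy
of the Duffing oscillator: a constant (`IsDuffingSolution.energy_eq`), positive since `δ > 0`. The
energy also bounds `y` and `y'`, hence the coefficients of `I`, so `I` is comparable with
`ξ² + ξ'²` uniformly in time. This bounds the phase point of every solution at any time by its value
at any other time (`exists_phase_sq_le`), which yields both claims.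
-/

/-- The quadratic first integral of the Hill equation `ξ'' + y² ξ = 0` attached to a solution `y`
of the Duffing equation. -/
noncomputable def hillInvariant (y ξ : ℝ → ℝ) (t : ℝ) : ℝ :=
  2 * deriv ξ t ^ 2 + y t ^ 2 * ξ t ^ 2 + (y t * deriv ξ t - deriv y t * ξ t) ^ 2

theorem ContDiff.hasDerivAt_deriv_of_two {f : ℝ → ℝ} (hf : ContDiff ℝ 2 f) (t : ℝ) :
    HasDerivAt f (deriv f t) t :=
  (hf.differentiable (by norm_num) t).hasDerivAt

theorem ContDiff.hasDerivAt_deriv_deriv_of_two {f : ℝ → ℝ} (hf : ContDiff ℝ 2 f) (t : ℝ) :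
    HasDerivAt (deriv f) (deriv (deriv f) t) t := by
  have h : ContDiff ℝ 1 (deriv f) := ((contDiff_succ_iff_deriv (n := 1)).1 hf).2.2
  exact (h.differentiable (by norm_num) t).hasDerivAt

theorem eq_of_forall_hasDerivAt_zero {f : ℝ → ℝ} (hf : ∀ t, HasDerivAt f 0 t) (s t : ℝ) :
    f s = f t :=
  is_const_of_deriv_eq_zero (fun t => (hf t).differentiableAt) (fun t => (hf t).deriv) s t

theorem IsDuffingSolution.energy_eq {δ : ℝ} {y : ℝ → ℝ} (hy : IsDuffingSolution δ y) (t : ℝ) :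
    2 * deriv y t ^ 2 + 2 * y t ^ 2 + y t ^ 4 = 2 * δ ^ 2 + δ ^ 4 := by
  have key : ∀ t, HasDerivAt (fun t => 2 * deriv y t ^ 2 + 2 * y t ^ 2 + y t ^ 4) 0 t := by
    intro t
    have h₀ := hy.contDiff.hasDerivAt_deriv_of_two t
    have h₁ := hy.contDiff.hasDerivAt_deriv_deriv_of_two t
    have h := (((h₁.pow 2).const_mul 2).add ((h₀.pow 2).const_mul 2)).add (h₀.pow 4)
    refine h.congr_deriv ?_
    norm_num
    linear_combination 4 * deriv y t * hy.ode t
  have h := eq_of_forall_hasDerivAt_zero key t 0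
  simpa [hy.init, hy.init_deriv] using h

theorem hillInvariant_eq {δ : ℝ} {y ξ : ℝ → ℝ} (hy : IsDuffingSolution δ y)
    (hξ : IsHillSolution (fun t => y t ^ 2) ξ) (s t : ℝ) :
    hillInvariant y ξ s = hillInvariant y ξ t := by
  refine eq_of_forall_hasDerivAt_zero (fun t => ?_) s t
  have hy₀ := hy.contDiff.hasDerivAt_deriv_of_two t
  have hy₁ := hy.contDiff.hasDerivAt_deriv_deriv_of_two t
  have hξ₀ := hξ.contDiff.hasDerivAt_deriv_of_two t
  have hξ₁ := hξ.contDiff.hasDerivAt_deriv_deriv_of_two t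
  have h := (((hξ₁.pow 2).const_mul 2).add ((hy₀.pow 2).mul (hξ₀.pow 2))).add
    (((hy₀.mul hξ₁).sub (hy₁.mul hξ₀)).pow 2)
  refine h.congr_deriv ?_
  norm_num
  linear_combination
    (4 * deriv ξ t + 2 * (y t * deriv ξ t - deriv y t * ξ t) * y t) * hξ.ode t
      - 2 * (y t * deriv ξ t - deriv y t * ξ t) * ξ t * hy.ode t

/-- The phase point `(ξ, ξ')` of a solution of the Hill equation at one time is controlled by the
phase point at any other time, with a constant depending only on `δ`. -/
theorem exists_phase_sq_le {δ : ℝ} (hδ : 0 < δ) {y : ℝ → ℝ} (hy : IsDuffingSolution δ y) :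
    ∃ C > 0, ∀ ξ, IsHillSolution (fun t => y t ^ 2) ξ → ∀ s t,
      ξ t ^ 2 + deriv ξ t ^ 2 ≤ C * (ξ s ^ 2 + deriv ξ s ^ 2) := by
  obtain ⟨A, hA⟩ : ∃ A, A = 2 * δ ^ 2 + δ ^ 4 := ⟨_, rfl⟩
  have hA₀ : 0 < A := by rw [hA]; positivity
  refine ⟨(2 + A) / A * (2 + A), by positivity, fun ξ hξ s t => ?_⟩
  have upper : hillInvariant y ξ s ≤ (2 + A) * (ξ s ^ 2 + deriv ξ s ^ 2) := by
    have hE := hy.energy_eq s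
    rw [← hA] at hE
    -- `I ≤ (2 + 2 y²) ξ'² + (y² + 2 y'²) ξ²`, and the energy bounds the coefficients.
    have h₁ : 0 ≤ (A - 2 * y s ^ 2) * deriv ξ s ^ 2 :=
      mul_nonneg (by nlinarith [sq_nonneg (deriv y s), sq_nonneg (y s ^ 2)]) (sq_nonneg _)
    have h₂ : 0 ≤ (2 + A - y s ^ 2 - 2 * deriv y s ^ 2) * ξ s ^ 2 :=
      mul_nonneg (by nlinarith [sq_nonneg (y s), sq_nonneg (y s ^ 2)]) (sq_nonneg _)
    unfold hillInvariant
    linarith [sq_nonneg (y s * deriv ξ s + deriv y s * ξ s)]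
  have lower : ξ t ^ 2 + deriv ξ t ^ 2 ≤ (2 + A) / A * hillInvariant y ξ t := by
    have hE := hy.energy_eq t
    rw [← hA] at hE
    have hI : 2 * deriv ξ t ^ 2 ≤ hillInvariant y ξ t := by
      unfold hillInvariant
      linarith [sq_nonneg (y t * ξ t), sq_nonneg (y t * deriv ξ t - deriv y t * ξ t)]
    -- Completing the square in `ξ'`: the remaining coefficient of `ξ²` is the energy constant.
    have hsq : (2 + y t ^ 2) * hillInvariant y ξ t
        = ((2 + y t ^ 2) * deriv ξ t - y t * deriv y t * ξ t) ^ 2 + A * ξ t ^ 2 := by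
      unfold hillInvariant
      linear_combination ξ t ^ 2 * hE
    have hI₀ : 0 ≤ hillInvariant y ξ t := by linarith [sq_nonneg (deriv ξ t)]
    have h₁ : 0 ≤ (A / 2 - y t ^ 2) * hillInvariant y ξ t :=
      mul_nonneg (by nlinarith [sq_nonneg (deriv y t), sq_nonneg (y t ^ 2)]) hI₀
    have h₂ : A * (2 * deriv ξ t ^ 2) ≤ A * hillInvariant y ξ t :=
      mul_le_mul_of_nonneg_left hI hA₀.le
    rw [div_mul_eq_mul_div, le_div_iff₀ hA₀]
    linarith [sq_nonneg ((2 + y t ^ 2) * deriv ξ t - y t * deriv y t * ξ t)]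
  calc ξ t ^ 2 + deriv ξ t ^ 2 ≤ (2 + A) / A * hillInvariant y ξ t := lower
    _ = (2 + A) / A * hillInvariant y ξ s := by rw [hillInvariant_eq hy hξ t s]
    _ ≤ (2 + A) / A * ((2 + A) * (ξ s ^ 2 + deriv ξ s ^ 2)) :=
      mul_le_mul_of_nonneg_left upper (by positivity)
    _ = (2 + A) / A * (2 + A) * (ξ s ^ 2 + deriv ξ s ^ 2) := by ring

theorem theorem3p1 (γ : ℝ) (hγ : γ = 0) (δ : ℝ) (hδ : 0 < δ)
    (y : ℝ → ℝ) (hy : IsDuffingSolution δ y) :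
    TrivialSolutionStable (squaredDuffing γ y) ∧ AllSolutionsBounded (squaredDuffing γ y) := by
  have hq : squaredDuffing γ y = fun t => y t ^ 2 := by
    funext t
    simp [squaredDuffing, hγ]
  rw [hq]
  obtain ⟨C, hC, bound⟩ := exists_phase_sq_le hδ hy
  constructor
  · intro t₀ ε hε
    refine ⟨ε / √(2 * C), by positivity, fun ξ hξ h₀ h₁ t => ?_⟩
    have hη : (ε / √(2 * C)) ^ 2 = ε ^ 2 / (2 * C) := by
      rw [div_pow, Real.sq_sqrt (by positivity)]
    have h₀' := sq_lt_sq' (abs_lt.1 h₀).1 (abs_lt.1 h₀).2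
    have h₁' := sq_lt_sq' (abs_lt.1 h₁).1 (abs_lt.1 h₁).2
    have hlt : ξ t ^ 2 + deriv ξ t ^ 2 < ε ^ 2 :=
      calc ξ t ^ 2 + deriv ξ t ^ 2 ≤ C * (ξ t₀ ^ 2 + deriv ξ t₀ ^ 2) := bound ξ hξ t₀ t
        _ < C * (ε ^ 2 / (2 * C) + ε ^ 2 / (2 * C)) := by
          rw [hη] at h₀' h₁'
          exact mul_lt_mul_of_pos_left (add_lt_add h₀' h₁') hC
        _ = ε ^ 2 := by field_simp; ring
    exact ⟨abs_lt_of_sq_lt_sq (by linarith [sq_nonneg (deriv ξ t)]) hε.le,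
      abs_lt_of_sq_lt_sq (by linarith [sq_nonneg (ξ t)]) hε.le⟩
  · intro ξ hξ
    refine ⟨√(C * (ξ 0 ^ 2 + deriv ξ 0 ^ 2)), fun t => Real.abs_le_sqrt ?_⟩
    linarith [bound ξ hξ 0 t, sq_nonneg (deriv ξ t)]
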